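/- Let $d\ge 2$. The proper edge $2d$-coloring problem $\Pi^d_{\chi',2d}$ on $\mathbb{Z}^d$, regarded as a locally checkable problem on the grid with edges oriented and labeled by the standard generators, belongs to the class $\mathsf{BOREL}$. Here each vertex $v$ is labeled by the $d$ colors, from a set of $2d$ colors, of its edges $\{v,e_i+v\}$, $1\le i\le d$, and the local constraint is that the $2d$ edges at each vertex have pairwise distinct colors; membership in $\mathsf{BOREL}$ means that for every free Borel action of $\mathbb{Z}^d$ on a standard Borel space $X$ there is a Borel measurable solution of $\Pi^d_{\chi',2d}$ on the graph on $X$ generated by the standard generators of $\mathbb{Z}^d$. In particular, if $\mathbb{Z}^d$ acts freely and in a Borel way on a non-empty standard Borel space $X$, and $\mathcal{G}$ is the Borel graph on $X$ generated by the standard generators $e_1,\dots,e_d$ (that is, $x$ and $y$ are adjacent if and only if $y=e_i\cdot x$ or $x=e_i\cdot y$ for some $i$), then the Borel edge chromatic number of $\mathcal{G}$, i.e. the least cardinality of a standard Borel space $Y$ such that $\mathcal{G}$ has a Borel proper edge coloring with colors in $Y$, is $\chi'_{\mathcal{B}}(\mathcal{G})=2d$. -/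

import Mathlib

universe u

/-- The ball of radius `t` around the origin in the grid `ℤ^d`; the graph distance of the standard
Cayley graph is the `ℓ¹` distance. -/
def gridBall (d t : ℕ) : Set (Fin d → ℤ) :=
  {v | ∑ i, (v i).natAbs ≤ t}

/-- A locally checkable problem on `ℤ^d`: finite sets of input and output labels, a radius `t`, and
a set of allowed labelled rooted grids of radius `t`. The edges of the grids are oriented and
labelled by the standard generators, so a labelled rooted grid of radius `t` is a labelling of the
ball of radius `t` around the origin. -/
structure LCL (d : ℕ) where
  inLabel : Type
  outLabel : Type
  finite_in : Finite inLabel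
  finite_out : Finite outLabel
  radius : ℕ
  allowed : Set (gridBall d radius → inLabel × outLabel)

/-- Given an action of `ℤ^d` on `X` and an input labelling `inp`, the output labelling `out` is a
`P`-coloring if the labelled `t`-neighbourhood of each point is allowed. -/
def LCL.IsColoring {d : ℕ} (P : LCL d) {X : Type u} [AddAction (Fin d → ℤ) X]
    (inp : X → P.inLabel) (out : X → P.outLabel) : Prop :=
  ∀ x : X, (fun v : gridBall d P.radius =>
    (inp ((v : Fin d → ℤ) +ᵥ x), out ((v : Fin d → ℤ) +ᵥ x))) ∈ P.allowed

/-- The action of `ℤ^d` on `X` is free: all stabilizers are trivial. -/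
def IsFreeAction (d : ℕ) (X : Type u) [AddAction (Fin d → ℤ) X] : Prop :=
  ∀ x : X, AddAction.stabilizer (Fin d → ℤ) x = ⊥

/-- The class BOREL: for every free Borel action of `ℤ^d` on a standard Borel space and every Borel
input labelling there is a Borel output labelling that solves the problem. The finite label sets
carry the discrete `σ`-algebra `⊤`. Since `ℤ^d` is countable and discrete, an action is Borel if and
only if each group element acts by a Borel map (`MeasurableConstVAdd`). -/
def LCL.InBorel {d : ℕ} (P : LCL d) : Prop :=
  ∀ (X : Type u) [MeasurableSpace X] [StandardBorelSpace X]
    [AddAction (Fin d → ℤ) X] [MeasurableConstVAdd (Fin d → ℤ) X],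
    IsFreeAction d X →
    ∀ inp : X → P.inLabel, @Measurable X P.inLabel _ ⊤ inp →
      ∃ out : X → P.outLabel, @Measurable X P.outLabel _ ⊤ out ∧ P.IsColoring inp out

theorem zero_mem_gridBall (d t : ℕ) : (0 : Fin d → ℤ) ∈ gridBall d t := by
  simp [gridBall]

theorem neg_single_mem_gridBall {d : ℕ} (i : Fin d) :
    -(Pi.single i 1 : Fin d → ℤ) ∈ gridBall d 1 := by
  have h : ∀ j, ((-(Pi.single i 1 : Fin d → ℤ)) j).natAbs = if j = i then 1 else 0 := by
    intro j
    by_cases hj : j = i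
    · subst hj; simp
    · simp [hj]
  simp only [gridBall, Set.mem_ofPred_eq, h]
  simp

/-- The proper edge `k`-coloring problem on `ℤ^d`, as an LCL without input. The label of a vertex
`v` lists the colors of the `d` edges `{v, e_i + v}`, and the constraint at the root says that the
`2d` edges `{0, e_i}` (pairs `(i, true)`) and `{-e_i, 0}` (pairs `(i, false)`) at the root have
pairwise distinct colors. -/
def edgeColoringLCL (d k : ℕ) : LCL d where
  inLabel := Unit
  outLabel := Fin d → Fin k
  finite_in := inferInstance
  finite_out := inferInstance
  radius := 1
  allowed := {L | Function.Injective fun p : Fin d × Bool =>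
    if p.2 then (L ⟨0, zero_mem_gridBall d 1⟩).2 p.1
    else (L ⟨-(Pi.single p.1 1 : Fin d → ℤ), neg_single_mem_gridBall p.1⟩).2 p.1}

/-- A Borel graph: a graph on a (standard Borel) space whose edge relation is a Borel subset of the
square. -/
structure BorelGraph (X : Type u) [MeasurableSpace X] extends SimpleGraph X where
  measurableSet_adj : MeasurableSet {p : X × X | Adj p.1 p.2}

/-- The Borel graph generated by the standard generators `e_1, …, e_d` of `ℤ^d` acting on `X`:
distinct points `x`, `y` are adjacent if `y = e_i + x` or `x = e_i + y` for some `i`. -/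
def actionGraph (d : ℕ) (X : Type u) [MeasurableSpace X] [StandardBorelSpace X]
    [AddAction (Fin d → ℤ) X] [MeasurableConstVAdd (Fin d → ℤ) X] : BorelGraph X where
  toSimpleGraph := SimpleGraph.fromRel fun x y : X =>
    ∃ i : Fin d, y = (Pi.single i 1 : Fin d → ℤ) +ᵥ x
  measurableSet_adj := by
    have h1 : ∀ g : Fin d → ℤ, MeasurableSet {p : X × X | p.2 = g +ᵥ p.1} := fun g =>
      measurableSet_eq_fun measurable_snd (measurable_fst.const_vadd g)
    have h2 : ∀ g : Fin d → ℤ, MeasurableSet {p : X × X | p.1 = g +ᵥ p.2} := fun g =>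
      measurableSet_eq_fun measurable_fst (measurable_snd.const_vadd g)
    have h3 : MeasurableSet {p : X × X | p.1 = p.2} :=
      measurableSet_eq_fun measurable_fst measurable_snd
    have h := h3.compl.inter
      ((MeasurableSet.iUnion fun i : Fin d => h1 (Pi.single i 1)).union
        (MeasurableSet.iUnion fun i : Fin d => h2 (Pi.single i 1)))
    convert h using 1
    ext p
    simp [SimpleGraph.fromRel_adj]

/-- A Borel proper edge coloring of `G` with color space `Y`: a Borel map on the edges, seen as a
symmetric Borel subset of `X × X`, that does not depend on the order of the endpoints and takes
distinct values on distinct edges that share an endpoint. -/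
def BorelGraph.IsBorelEdgeColoring {X : Type u} [MeasurableSpace X] (G : BorelGraph X)
    {Y : Type} [MeasurableSpace Y] (c : {p : X × X // G.Adj p.1 p.2} → Y) : Prop :=
  Measurable c ∧
  (∀ (x y : X) (h : G.Adj x y), c ⟨(x, y), h⟩ = c ⟨(y, x), h.symm⟩) ∧
  (∀ (x y z : X) (hy : G.Adj x y) (hz : G.Adj x z),
    y ≠ z → c ⟨(x, y), hy⟩ ≠ c ⟨(x, z), hz⟩)

/-- The Borel edge chromatic number: the least cardinality of a standard Borel space `Y` such that
`G` has a Borel proper edge coloring with color space `Y`. -/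
noncomputable def BorelGraph.borelEdgeChromaticNumber {X : Type u} [MeasurableSpace X]
    (G : BorelGraph X) : Cardinal.{0} :=
  sInf {κ | ∃ (Y : Type) (_ : MeasurableSpace Y) (_ : StandardBorelSpace Y)
    (c : {p : X × X // G.Adj p.1 p.2} → Y),
    G.IsBorelEdgeColoring c ∧ Cardinal.mk Y = κ}

/-! A parity that alternates along every `e_i`-line would give the colouring at once: at `z`, colour
the half-edge in direction `±e_i` by `i` together with the sign, twisted by the `i`-th parity of
`z`. The two halves of an edge get the same colour exactly when the parity alternates along it. In
general no global Borel parity exists, so it is taken locally, relative to markers of a toast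
(`exists_toast`), and fails to alternate only at some edges that cross boundaries.

For each direction `i` the toast pieces are thickened by a different amount and rounded to blocks of
side 2 (`Toast.layer`), and the `i`-th phase of a point is its parity relative to the marker of the
first layer containing it. Boundaries of different levels or directions are far apart
(`Toast.near_unique`). Because of the blocks, the bad `i`-edges come in parallel pairs, which span
disjoint squares in directions `i` and `p i`, where `p i ≠ i`; this is where `2 ≤ d` enters.
Swapping, at each corner of a bad square, the colours of the two half-edges of the square repairs
it: the `i`-edges now use the `p i` phase, which is constant along them, and the `p i`-edges use the
`i` phase, constant along those (`Toast.color_single_vadd`). At a vertex the colouring stays a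
bijection from half-edges to colours, so it is proper. The lower bound `2d` is the degree of a
vertex under a free action. -/

/-- The ball of radius `r` around the origin of `ℤ^d` in the supremum norm. -/
def box (d r : ℕ) : Set (Fin d → ℤ) :=
  {g | ∀ k, |g k| ≤ (r : ℤ)}

theorem box_mono {d r s : ℕ} (h : r ≤ s) : box d r ⊆ box d s := fun g hg k =>
  (hg k).trans (by exact_mod_cast h)

theorem zero_mem_box (d r : ℕ) : (0 : Fin d → ℤ) ∈ box d r := fun k => by simp

theorem add_mem_box {d r s t : ℕ} {g h : Fin d → ℤ} (hg : g ∈ box d r) (hh : h ∈ box d s)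
    (ht : r + s ≤ t) : g + h ∈ box d t := fun k => by
  have h1 := hg k
  have h2 := hh k
  rw [abs_le] at *
  simp only [Pi.add_apply]
  omega

theorem neg_mem_box {d r : ℕ} {g : Fin d → ℤ} (hg : g ∈ box d r) : -g ∈ box d r := fun k => by
  simpa using hg k

theorem sub_mem_box {d r s t : ℕ} {g h : Fin d → ℤ} (hg : g ∈ box d r) (hh : h ∈ box d s)
    (ht : r + s ≤ t) : g - h ∈ box d t := by
  rw [sub_eq_add_neg]
  exact add_mem_box hg (neg_mem_box hh) ht

theorem single_mem_box {d : ℕ} (k : Fin d) : (Pi.single k 1 : Fin d → ℤ) ∈ box d 1 := fun l => by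
  by_cases h : l = k
  · subst h; simp
  · simp [h]

theorem finite_box (d r : ℕ) : (box d r).Finite := by
  refine (Set.finite_Icc (fun _ : Fin d => -(r : ℤ)) (fun _ => (r : ℤ))).subset fun g hg => ?_
  exact ⟨fun k => (abs_le.1 (hg k)).1, fun k => (abs_le.1 (hg k)).2⟩

theorem exists_mem_box {d : ℕ} (g : Fin d → ℤ) : ∃ r, g ∈ box d r := by
  refine ⟨∑ k, (g k).natAbs, fun k => ?_⟩
  rw [Int.abs_eq_natAbs]
  exact_mod_cast Finset.single_le_sum (f := fun k => (g k).natAbs) (fun _ _ => Nat.zero_le _)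
    (Finset.mem_univ k)

/-- The points whose `r`-box meets `S`. -/
def nbhd (d r : ℕ) {X : Type u} [AddAction (Fin d → ℤ) X] (S : Set X) : Set X :=
  {x | ∃ g ∈ box d r, g +ᵥ x ∈ S}

section nbhd

variable {d : ℕ} {X : Type u} [AddAction (Fin d → ℤ) X]

theorem nbhd_mono {r s : ℕ} (h : r ≤ s) (S : Set X) : nbhd d r S ⊆ nbhd d s S :=
  fun _ ⟨g, hg, hx⟩ => ⟨g, box_mono h hg, hx⟩

theorem subset_nbhd (r : ℕ) (S : Set X) : S ⊆ nbhd d r S := fun x hx =>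
  ⟨0, zero_mem_box d r, by simpa using hx⟩

theorem mem_nbhd_of_vadd_mem {r s t : ℕ} {S : Set X} {g : Fin d → ℤ} {x : X} (hg : g ∈ box d r)
    (hx : g +ᵥ x ∈ nbhd d s S) (ht : r + s ≤ t) : x ∈ nbhd d t S := by
  obtain ⟨h, hh, hS⟩ := hx
  exact ⟨h + g, add_mem_box hh hg (by omega), by rwa [add_vadd]⟩

theorem vadd_mem_nbhd {r s t : ℕ} {S : Set X} {g : Fin d → ℤ} {x : X} (hg : g ∈ box d r)
    (hx : x ∈ nbhd d s S) (ht : r + s ≤ t) : g +ᵥ x ∈ nbhd d t S :=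
  mem_nbhd_of_vadd_mem (neg_mem_box hg) (by simpa using hx) ht

theorem nbhd_subset_nbhd {r s t : ℕ} {S T : Set X} (h : S ⊆ nbhd d s T) (ht : r + s ≤ t) :
    nbhd d r S ⊆ nbhd d t T :=
  fun _ ⟨_, hg, hx⟩ => mem_nbhd_of_vadd_mem hg (h hx) ht

theorem measurableSet_nbhd [MeasurableSpace X] [MeasurableConstVAdd (Fin d → ℤ) X] (r : ℕ)
    {S : Set X} (hS : MeasurableSet S) : MeasurableSet (nbhd d r S) := by
  have : nbhd d r S = ⋃ g ∈ box d r, (fun x => g +ᵥ x) ⁻¹' S := by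
    ext x; simp [nbhd]
  rw [this]
  exact MeasurableSet.biUnion (finite_box d r).countable fun g _ => measurable_const_vadd g hS

end nbhd

/-! ### Borel maximal separated sets -/

/-- Distinct points of `C` are not in each other's `r`-box. -/
def BoxSeparated (d r : ℕ) {X : Type u} [AddAction (Fin d → ℤ) X] (C : Set X) : Prop :=
  ∀ x ∈ C, ∀ g ∈ box d r, g +ᵥ x ∈ C → g = 0

theorem BoxSeparated.offset_unique {d r s t : ℕ} {X : Type u} [AddAction (Fin d → ℤ) X]
    {C : Set X} (hC : BoxSeparated d r C) {x : X} {a b : Fin d → ℤ} (ha : a ∈ box d s)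
    (hb : b ∈ box d t) (hr : s + t ≤ r) (hax : a +ᵥ x ∈ C) (hbx : b +ᵥ x ∈ C) : a = b := by
  refine sub_eq_zero.1 (hC _ hbx _ (sub_mem_box ha hb hr) ?_)
  rwa [vadd_vadd, sub_add_cancel]

theorem IsFreeAction.eq_zero {d : ℕ} {X : Type u} [AddAction (Fin d → ℤ) X]
    (h : IsFreeAction d X) {g : Fin d → ℤ} {x : X} (hg : g +ᵥ x = x) : g = 0 := by
  have : g ∈ AddAction.stabilizer (Fin d → ℤ) x := hg
  rwa [h x, AddSubgroup.mem_bot] at this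

/-- By freeness `x` differs from its finitely many translates by nonzero elements of the box, so
some basic open set contains `x` and none of them. Each `W n` collects the points that the `n`-th
basic set isolates in this way. -/
theorem exists_boxSeparated_cover {d : ℕ} {X : Type u} [MeasurableSpace X] [StandardBorelSpace X]
    [AddAction (Fin d → ℤ) X] [MeasurableConstVAdd (Fin d → ℤ) X] (h : IsFreeAction d X) (r : ℕ) :
    ∃ W : ℕ → Set X, (∀ n, MeasurableSet (W n)) ∧ (∀ n, BoxSeparated d r (W n)) ∧
      ∀ x, ∃ n, x ∈ W n := by
  let _ := upgradeStandardBorel X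
  -- Inserting `∅` makes the family nonempty, so it can be enumerated by `ℕ` even if `X` is empty.
  obtain ⟨B, hB⟩ := ((TopologicalSpace.countable_countableBasis X).insert
    ∅).exists_eq_range (Set.insert_nonempty _ _)
  have hBm : ∀ n, MeasurableSet (B n) := fun n => by
    rcases hB.symm ▸ Set.mem_range_self (f := B) n with h0 | h0
    · exact h0 ▸ MeasurableSet.empty
    · exact (TopologicalSpace.isOpen_of_mem_countableBasis h0).measurableSet
  have hfin : (box d r \ {0}).Countable := ((finite_box d r).subset Set.sdiff_subset).countable
  refine ⟨fun n => B n ∩ ⋂ g ∈ box d r \ {0}, (fun x => g +ᵥ x) ⁻¹' (B n)ᶜ, fun n => ?_, ?_, ?_⟩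
  · exact (hBm n).inter (MeasurableSet.biInter hfin
      fun g _ => measurable_const_vadd g (hBm n).compl)
  · rintro n x ⟨-, hx⟩ g hg ⟨hgx, -⟩
    by_contra h0
    exact Set.mem_iInter₂.1 hx g ⟨hg, h0⟩ hgx
  · intro x
    have hF : ((fun g : Fin d → ℤ => g +ᵥ x) '' (box d r \ {0})).Finite :=
      ((finite_box d r).subset Set.sdiff_subset).image _
    have hx : x ∈ ((fun g : Fin d → ℤ => g +ᵥ x) '' (box d r \ {0}))ᶜ := by
      rintro ⟨g, ⟨-, hg⟩, hgx⟩
      exact hg (h.eq_zero hgx)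
    obtain ⟨V, hV, hxV, hVs⟩ := (TopologicalSpace.isBasis_countableBasis X).exists_subset_of_mem_open
      hx hF.isClosed.isOpen_compl
    obtain ⟨n, rfl⟩ := hB ▸ Set.mem_insert_of_mem ∅ hV
    refine ⟨n, hxV, Set.mem_iInter₂.2 fun g hg hgx => hVs hgx ⟨g, hg, rfl⟩⟩

/-- Greedy selection from a sequence of sets: a point of `W n` is kept unless its `r`-box meets
the points kept from `W 0, …, W (n - 1)`. -/
def greedy (d r : ℕ) {X : Type u} [AddAction (Fin d → ℤ) X] (W : ℕ → Set X) : ℕ → Set X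
  | 0 => ∅
  | n + 1 => greedy d r W n ∪ (W n \ nbhd d r (greedy d r W n))

/-- Greedy selection through the countable cover gives a maximal separated set: a point is rejected
only when a kept point already lies in its box. -/
theorem exists_markers {d : ℕ} {X : Type u} [MeasurableSpace X] [StandardBorelSpace X]
    [AddAction (Fin d → ℤ) X] [MeasurableConstVAdd (Fin d → ℤ) X] (h : IsFreeAction d X) (r : ℕ) :
    ∃ C : Set X, MeasurableSet C ∧ BoxSeparated d r C ∧ ∀ x, x ∈ nbhd d r C := by
  obtain ⟨W, hWm, hWs, hW⟩ := exists_boxSeparated_cover h r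
  have hmono : Monotone (greedy d r W) := monotone_nat_of_le_succ fun n => Set.subset_union_left
  have hsep : ∀ n, BoxSeparated d r (greedy d r W n) := by
    intro n
    induction n with
    | zero => exact fun x hx => hx.elim
    | succ n ih =>
      rintro x (hx | ⟨hxW, hx⟩) g hg (hgx | ⟨hgxW, hgx⟩)
      · exact ih x hx g hg hgx
      · exact (hgx ⟨-g, neg_mem_box hg, by simpa using hx⟩).elim
      · exact (hx ⟨g, hg, hgx⟩).elim
      · exact hWs n x hxW g hg hgxW
  refine ⟨⋃ n, greedy d r W n, MeasurableSet.iUnion fun n => ?_, ?_, fun x => ?_⟩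
  · induction n with
    | zero => exact MeasurableSet.empty
    | succ n ih => exact ih.union ((hWm n).diff (measurableSet_nbhd r ih))
  · intro x hx g hg hgx
    obtain ⟨m, hm⟩ := Set.mem_iUnion.1 hx
    obtain ⟨n, hn⟩ := Set.mem_iUnion.1 hgx
    exact hsep (max m n) x (hmono (le_max_left m n) hm) g hg (hmono (le_max_right m n) hn)
  · obtain ⟨n, hn⟩ := hW x
    by_cases hx : x ∈ nbhd d r (greedy d r W n)
    · obtain ⟨g, hg, hgx⟩ := hx
      exact ⟨g, hg, Set.mem_iUnion.2 ⟨n, hgx⟩⟩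
    · exact subset_nbhd r _ (Set.mem_iUnion.2 ⟨n + 1, Or.inr ⟨hn, hx⟩⟩)

/-- There are only finitely many subsets of `A`, so `F` may be arbitrary, even defined by choice. -/
theorem measurable_top_of_finite {X A B : Type*} [MeasurableSpace X] [Finite A] (S : X → Set A)
    (hS : ∀ a, MeasurableSet {x | a ∈ S x}) (F : Set A → B) :
    @Measurable X B _ ⊤ (fun x => F (S x)) := by
  let _ : MeasurableSpace B := ⊤
  have h1 : Measurable S := measurable_set_iff.2 fun a => measurableSet_setOfPred.1 (hS a)
  exact (measurable_of_countable F).comp h1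

/-! ### Markers that come comparatively close to every point -/

section markers

variable {d : ℕ} {X : Type u} [AddAction (Fin d → ℤ) X]

/-- The directions `j` in which, seen from some point of the orbit of `x` and for infinitely many
`n`, there is a point of `C n` at a place that rounds down to `κ n • j`. -/
def recurrentDirections (κ : ℕ → ℕ) (C : ℕ → Set X) (x : X) : Set (box d 8) :=
  {j | ∃ h : Fin d → ℤ, ∀ N, ∃ n ≥ N, ∃ g : Fin d → ℤ,
    (∀ k, g k / (κ n : ℤ) = j.1 k) ∧ g +ᵥ (h +ᵥ x) ∈ C n}

theorem recurrentDirections_vadd (κ : ℕ → ℕ) (C : ℕ → Set X) (x : X) (g : Fin d → ℤ) :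
    recurrentDirections (d := d) κ C (g +ᵥ x) = recurrentDirections κ C x := by
  ext j
  constructor
  · rintro ⟨h, hh⟩
    exact ⟨h + g, by simpa only [add_vadd] using hh⟩
  · rintro ⟨h, hh⟩
    exact ⟨h - g, by simpa only [vadd_vadd (h - g) g x, sub_add_cancel] using hh⟩

/-- Pigeonhole: the rounded offsets to the markers of all scales lie in the finite box of radius 8,
so one value occurs infinitely often. -/
theorem recurrentDirections_nonempty {κ : ℕ → ℕ} (hκ : ∀ n, 0 < κ n) {C : ℕ → Set X}
    (hC : ∀ n x, x ∈ nbhd d (8 * κ n) (C n)) (x : X) :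
    (recurrentDirections (d := d) κ C x).Nonempty := by
  have : Finite (box d 8) := finite_box d 8
  choose g hg hgC using fun n => hC n x
  have hj : ∀ n, (fun k => g n k / (κ n : ℤ)) ∈ box d 8 := fun n k => by
    have hp : (0 : ℤ) < κ n := by exact_mod_cast hκ n
    have := abs_le.1 (hg n k)
    push_cast at this
    rw [abs_le]
    constructor
    · rw [Int.le_ediv_iff_mul_le hp]
      push_cast
      linarith
    · have h2 : g n k / (κ n : ℤ) < 9 := by
        rw [Int.ediv_lt_iff_lt_mul hp]; linarith
      push_cast
      omega
  obtain ⟨j, hj'⟩ := Finite.exists_infinite_fiber fun n => (⟨_, hj n⟩ : box d 8)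
  rw [Set.infinite_coe_iff] at hj'
  refine ⟨j, 0, fun N => ?_⟩
  obtain ⟨n, hn, hN⟩ := hj'.exists_gt N
  refine ⟨n, hN.le, g n, fun k => ?_, by simpa using hgC n⟩
  have : (⟨_, hj n⟩ : box d 8) = j := hn
  rw [← this]

open Classical in
/-- An element of `A`, if there is one. -/
noncomputable def chooseDirection (A : Set (box d 8)) : box d 8 :=
  if h : A.Nonempty then h.choose else ⟨0, zero_mem_box d 8⟩

/-- A recurrent direction, chosen as a function of the orbit. -/
noncomputable def recurrentDirection (κ : ℕ → ℕ) (C : ℕ → Set X) (x : X) : box d 8 :=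
  chooseDirection (recurrentDirections κ C x)

theorem measurableSet_recurrentDirection_eq [MeasurableSpace X]
    [MeasurableConstVAdd (Fin d → ℤ) X] (κ : ℕ → ℕ) {C : ℕ → Set X}
    (hC : ∀ n, MeasurableSet (C n)) (j : box d 8) :
    MeasurableSet {x | recurrentDirection κ C x = j} := by
  classical
  have : Finite (box d 8) := finite_box d 8
  have hm := measurable_top_of_finite (recurrentDirections (d := d) κ C) (fun j => ?_)
    chooseDirection
  · exact hm (MeasurableSpace.measurableSet_top (s := {j}))
  · have : {x | j ∈ recurrentDirections κ C x} = ⋃ h : Fin d → ℤ, ⋂ N : ℕ, ⋃ n : ℕ,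
        ⋃ _ : n ≥ N, ⋃ g : Fin d → ℤ, ⋃ _ : ∀ k, g k / (κ n : ℤ) = j.1 k,
        (fun x => g +ᵥ (h +ᵥ x)) ⁻¹' C n := by
      ext x
      simp [recurrentDirections]
    rw [this]
    refine .iUnion fun h => .iInter fun N => .iUnion fun n => .iUnion fun _ => .iUnion fun g =>
      .iUnion fun _ => ((measurable_const_vadd g).comp (measurable_const_vadd h)) (hC n)

/-- Boykin–Jackson: markers that are comparatively close to every point at some scale. -/
theorem exists_recurrent_markers [MeasurableSpace X] [StandardBorelSpace X]
    [MeasurableConstVAdd (Fin d → ℤ) X] (hfree : IsFreeAction d X) (κ : ℕ → ℕ)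
    (hκ : ∀ n, n < κ n) :
    ∃ C : ℕ → Set X, (∀ n, MeasurableSet (C n)) ∧ (∀ n, BoxSeparated d (8 * κ n) (C n)) ∧
      ∀ x, ∃ n, x ∈ nbhd d (2 * κ n) (C n) := by
  choose C hCm hCs hC using fun n => exists_markers hfree (8 * κ n)
  -- Translating `C n` by `κ n` times the recurrent direction brings it close. The translation is
  -- constant on orbits, so separation survives.
  let v : ℕ → X → Fin d → ℤ := fun n x k => κ n * (recurrentDirection κ C x).1 k
  have hv : ∀ n x (g : Fin d → ℤ), v n (g +ᵥ x) = v n x := fun n x g => by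
    simp only [v, recurrentDirection, recurrentDirections_vadd]
  refine ⟨fun n => {x | v n x +ᵥ x ∈ C n}, fun n => ?_, fun n x hx g hg hgx => ?_, fun x => ?_⟩
  · have : {x | v n x +ᵥ x ∈ C n} = ⋃ j : box d 8, {x | recurrentDirection κ C x = j} ∩
        (fun x => (fun k => (κ n : ℤ) * j.1 k : Fin d → ℤ) +ᵥ x) ⁻¹' C n := by
      ext x
      simp [v]
    change MeasurableSet {x | v n x +ᵥ x ∈ C n}
    rw [this]
    have : Finite (box d 8) := finite_box d 8
    exact .iUnion fun j => (measurableSet_recurrentDirection_eq κ hCm j).inter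
      (measurable_const_vadd _ (hCm n))
  · refine hCs n _ hx g hg ?_
    have h : v n (g +ᵥ x) +ᵥ (g +ᵥ x) ∈ C n := hgx
    rwa [hv, vadd_vadd, add_comm, ← vadd_vadd] at h
  · have hne := recurrentDirections_nonempty (d := d) (fun n => (Nat.zero_le n).trans_lt (hκ n)) hC x
    have hj : recurrentDirection (d := d) κ C x ∈ recurrentDirections κ C x := by
      unfold recurrentDirection chooseDirection
      rw [dif_pos hne]
      exact hne.choose_spec
    obtain ⟨h, hh⟩ := hj
    obtain ⟨r, hr⟩ := exists_mem_box h
    -- A scale `n ≥ r` makes the displacement `h` at most `κ n`; the rounding error costs at most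
    -- another `κ n`, whence `2 * κ n`.
    obtain ⟨n, hn, g, hg, hgC⟩ := hh r
    refine ⟨n, (g - v n x) + h, add_mem_box (r := κ n) (s := κ n) (fun k => ?_)
      (box_mono (hn.trans (hκ n).le) hr) (by omega), ?_⟩
    · have hp : (0 : ℤ) < κ n := by exact_mod_cast (Nat.zero_le n).trans_lt (hκ n)
      have h1 := Int.emod_add_mul_ediv (g k) (κ n)
      have h2 := Int.emod_nonneg (g k) hp.ne'
      have h3 := Int.emod_lt_of_pos (g k) hp
      rw [hg k] at h1
      simp only [Pi.sub_apply, v]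
      rw [abs_le]
      constructor <;> linarith
    · change v n ((g - v n x + h) +ᵥ x) +ᵥ ((g - v n x + h) +ᵥ x) ∈ C n
      rw [hv, vadd_vadd]
      rw [vadd_vadd] at hgC
      convert hgC using 2
      abel

end markers

/-! ### Construction of the toast -/

section toast

variable {d : ℕ} {X : Type u} [AddAction (Fin d → ℤ) X]

/-- `Chain d s U x g`: one can go from `x` to `g +ᵥ x` inside `U` with steps from the `s`-box. -/
inductive Chain (d s : ℕ) {X : Type u} [AddAction (Fin d → ℤ) X] (U : Set X) (x : X) :
    (Fin d → ℤ) → Prop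
  | start : x ∈ U → Chain d s U x 0
  | step {g h : Fin d → ℤ} : Chain d s U x g → h ∈ box d s → (h + g) +ᵥ x ∈ U →
      Chain d s U x (h + g)

/-- Between visits to `D` a chain moves by at most `T` plus two jumps, too little to pass from one
marker of `C` to another. So all visits are near a single marker: the excursions before and after
cost `T + 2q` each, and crossing the `R`-ball of the marker costs `2R`. -/
theorem Chain.union_mem_box {q T R : ℕ} {U D C : Set X}
    (hU : ∀ x g, Chain d (2 * q) U x g → g ∈ box d T) (hD : D ⊆ nbhd d R C)
    (hC : BoxSeparated d (2 * R + T + 4 * q) C) (x : X) (g : Fin d → ℤ)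
    (h : Chain d (2 * q) (U ∪ D) x g) : g ∈ box d (2 * T + 2 * R + 4 * q) := by
  -- Here `a` is the only marker met so far and `g'` the last visit to `D`; since then the chain has
  -- stayed in `U`.
  have key : Chain d (2 * q) U x g ∨ ∃ a ∈ box d (T + 2 * q + R), a +ᵥ x ∈ C ∧ ∃ g',
      g' - a ∈ box d R ∧ (g = g' ∨ ∃ s ∈ box d (2 * q),
        Chain d (2 * q) U ((s + g') +ᵥ x) (g - (s + g'))) := by
    induction h with
    | start hx =>
      rcases hx with hx | hx
      · exact Or.inl (.start hx)
      · obtain ⟨a, ha, hax⟩ := hD hx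
        exact Or.inr ⟨a, box_mono (by omega) ha, hax, 0,
          by simpa using neg_mem_box ha, Or.inl rfl⟩
    | @step g h hg hh hx ih =>
      rcases hx with hx | hx
      · rcases ih with ih | ⟨a, ha, hax, g', hg', rfl | ⟨s, hs, ih⟩⟩
        · exact Or.inl (ih.step hh hx)
        · refine Or.inr ⟨a, ha, hax, g, hg', Or.inr ⟨h, hh, ?_⟩⟩
          rw [sub_self]
          exact .start hx
        · refine Or.inr ⟨a, ha, hax, g', hg', Or.inr ⟨s, hs, ?_⟩⟩
          rw [add_sub_assoc]
          refine ih.step hh ?_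
          rwa [vadd_vadd, add_assoc, sub_add_cancel]
      · obtain ⟨b, hb, hbx⟩ := hD hx
        rw [vadd_vadd] at hbx
        rcases ih with ih | ⟨a, ha, hax, g', hg', ih⟩
        · refine Or.inr ⟨b + (h + g), ?_, hbx, h + g, ?_, Or.inl rfl⟩
          · exact add_mem_box hb (add_mem_box hh (hU _ _ ih) le_rfl) (by omega)
          · simpa using neg_mem_box hb
        · have h1 : g - g' ∈ box d (T + 2 * q) := by
            rcases ih with rfl | ⟨s, hs, ih⟩
            · rw [sub_self]
              exact zero_mem_box _ _
            · have := add_mem_box (hU _ _ ih) hs le_rfl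
              rwa [← sub_sub, sub_right_comm, sub_add_cancel] at this
          have h2 : b + (h + g) - a ∈ box d (2 * R + T + 4 * q) := by
            have := add_mem_box (add_mem_box hb hh le_rfl) (add_mem_box h1 hg' le_rfl)
              (t := 2 * R + T + 4 * q) (by omega)
            convert this using 1
            abel
          have h3 := (sub_eq_zero.1 (hC _ hax _ h2 (by rwa [vadd_vadd, sub_add_cancel]))).symm
          refine Or.inr ⟨a, ha, hax, h + g, ?_, Or.inl rfl⟩
          rw [h3]
          simpa using neg_mem_box hb
  rcases key with h | ⟨a, ha, -, g', hg', rfl | ⟨s, hs, h⟩⟩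
  · exact box_mono (by omega) (hU _ _ h)
  · have := add_mem_box hg' ha (t := 2 * T + 2 * R + 4 * q) (by omega)
    rwa [sub_add_cancel] at this
  · have := add_mem_box (add_mem_box (hU _ _ h) hs le_rfl) (add_mem_box hg' ha le_rfl)
      (t := 2 * T + 2 * R + 4 * q) (by omega)
    rwa [sub_add_cancel, ← sub_sub, sub_right_comm, sub_add_cancel, sub_add_cancel] at this

/-- The stages of the least set that contains `E` and the `q`-neighbourhoods of all points of `U`
that are `q`-close to it. -/
def toastStage (d q : ℕ) {X : Type u} [AddAction (Fin d → ℤ) X] (U E : Set X) : ℕ → Set X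
  | 0 => E
  | k + 1 => toastStage d q U E k ∪ nbhd d q (U ∩ nbhd d q (toastStage d q U E k))

/-- The least set that contains `E` and the `q`-neighbourhoods of all points of `U` that are
`q`-close to it. -/
def toastClosure (d q : ℕ) {X : Type u} [AddAction (Fin d → ℤ) X] (U E : Set X) : Set X :=
  ⋃ k, toastStage d q U E k

theorem subset_toastClosure (q : ℕ) (U E : Set X) : E ⊆ toastClosure d q U E :=
  Set.subset_iUnion (toastStage d q U E) 0

theorem measurableSet_toastClosure [MeasurableSpace X] [MeasurableConstVAdd (Fin d → ℤ) X]
    (q : ℕ) {U E : Set X} (hU : MeasurableSet U) (hE : MeasurableSet E) :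
    MeasurableSet (toastClosure d q U E) := by
  refine MeasurableSet.iUnion fun k => ?_
  induction k with
  | zero => exact hE
  | succ k ih => exact ih.union (measurableSet_nbhd q (hU.inter (measurableSet_nbhd q ih)))

theorem vadd_mem_toastClosure {q : ℕ} {U E : Set X} {y : X} (hy : y ∈ U)
    (hyD : y ∈ nbhd d q (toastClosure d q U E)) {g : Fin d → ℤ} (hg : g ∈ box d q) :
    g +ᵥ y ∈ toastClosure d q U E := by
  obtain ⟨h, hh, hhy⟩ := hyD
  obtain ⟨k, hk⟩ := Set.mem_iUnion.1 hhy
  exact Set.mem_iUnion.2 ⟨k + 1, Or.inr ⟨-g, neg_mem_box hg, by simpa using ⟨hy, h, hh, hk⟩⟩⟩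

/-- Consecutive points of `U` used in the growth are at most `2q` apart, so the growth follows a
chain in `U`, whose displacement is at most `T`; getting from `E` to the chain and from the chain to
the added point costs `q` each. -/
theorem toastClosure_subset {q T : ℕ} {U E : Set X}
    (hU : ∀ x g, Chain d (2 * q) U x g → g ∈ box d T) :
    toastClosure d q U E ⊆ nbhd d (T + 2 * q) E := by
  have key : ∀ k, ∀ z ∈ toastStage d q U E k, z ∈ E ∨ ∃ u ∈ nbhd d q E, ∃ g,
      Chain d (2 * q) U u g ∧ ∃ h ∈ box d q, h +ᵥ z = g +ᵥ u := by
    intro k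
    induction k with
    | zero => exact fun z hz => Or.inl hz
    | succ k ih =>
      rintro z (hz | ⟨a, ha, hazU, b, hb, hbz⟩)
      · exact ih z hz
      · right
        rcases ih _ hbz with h | ⟨u, hu, g, hg, h, hh, hz⟩
        · exact ⟨a +ᵥ z, ⟨b, hb, h⟩, 0, .start hazU, a, ha, by simp⟩
        · have h1 : a +ᵥ z = ((-b + -h) + g) +ᵥ u := by
            rw [add_vadd, ← hz, vadd_vadd (-b + -h)]
            simp
          refine ⟨u, hu, (-b + -h) + g, hg.step ?_ (h1 ▸ hazU), a, ha, h1⟩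
          exact add_mem_box (neg_mem_box hb) (neg_mem_box hh) (by omega)
  intro z hz
  obtain ⟨k, hk⟩ := Set.mem_iUnion.1 hz
  rcases key k z hk with h | ⟨u, hu, g, hg, h, hh, hz⟩
  · exact subset_nbhd _ _ h
  · exact mem_nbhd_of_vadd_mem hh (hz ▸ vadd_mem_nbhd (hU _ _ hg) hu le_rfl) (by omega)

/-- The union of the first `n` levels of the toast grown from the sets `E 0, E 1, …`. -/
def toastUnion (d q : ℕ) {X : Type u} [AddAction (Fin d → ℤ) X] (E : ℕ → Set X) : ℕ → Set X
  | 0 => ∅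
  | n + 1 => toastUnion d q E n ∪ toastClosure d q (toastUnion d q E n) (E n)

theorem toastClosure_subset_toastUnion (q : ℕ) (E : ℕ → Set X) {m n : ℕ} (h : m < n) :
    toastClosure d q (toastUnion d q E m) (E m) ⊆ toastUnion d q E n := by
  have hmono : Monotone (toastUnion d q E) := monotone_nat_of_le_succ fun n => Set.subset_union_left
  exact Set.subset_union_right.trans (hmono h)

theorem measurableSet_toastUnion [MeasurableSpace X] [MeasurableConstVAdd (Fin d → ℤ) X]
    (q : ℕ) {E : ℕ → Set X} (hE : ∀ n, MeasurableSet (E n)) (n : ℕ) :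
    MeasurableSet (toastUnion d q E n) := by
  induction n with
  | zero => exact MeasurableSet.empty
  | succ n ih => exact ih.union (measurableSet_toastClosure q ih (hE n))

/-- A bound for the displacement along chains in the first `n` levels of the toast. -/
def toastDiam (q : ℕ) : ℕ → ℕ
  | 0 => 0
  | n + 1 => 2 * toastDiam q n + 2 * (2 * (4 * toastDiam q n + 10 * q + n + 1) +
      toastDiam q n + 2 * q) + 4 * q

/-- Toast: a sequence of Borel sets that covers `X`, with far apart boundaries, each within bounded
distance of a much sparser set of markers. -/
theorem exists_toast [MeasurableSpace X] [StandardBorelSpace X]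
    [MeasurableConstVAdd (Fin d → ℤ) X] (hfree : IsFreeAction d X) (q : ℕ) :
    ∃ (R : ℕ → ℕ) (C D : ℕ → Set X), (∀ n, MeasurableSet (C n)) ∧ (∀ n, MeasurableSet (D n)) ∧
      (∀ n, BoxSeparated d (2 * R n + 8 * q) (C n)) ∧ (∀ n, D n ⊆ nbhd d (R n) (C n)) ∧
      (∀ x, ∃ n, x ∈ D n) ∧
      ∀ m n, m < n → ∀ y ∈ D m, y ∈ nbhd d q (D n) → ∀ g ∈ box d q, g +ᵥ y ∈ D n := by
  -- Large enough that, with `R n` below, both separations needed, `2 * R n + toastDiam q n + 4 * q`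
  -- and `2 * R n + 8 * q`, are at most `8 * κ n`.
  let κ : ℕ → ℕ := fun n => 4 * toastDiam q n + 10 * q + n + 1
  obtain ⟨C, hCm, hCs, hC⟩ := exists_recurrent_markers hfree κ (fun n => by simp only [κ]; omega)
  have hsep : ∀ n r, r ≤ 8 * κ n → BoxSeparated d r (C n) := fun n r hr x hx g hg =>
    hCs n x hx g (box_mono hr hg)
  let E : ℕ → Set X := fun n => nbhd d (2 * κ n) (C n)
  let U := toastUnion d q E
  let R : ℕ → ℕ := fun n => 2 * κ n + toastDiam q n + 2 * q
  have hEm : ∀ n, MeasurableSet (E n) := fun n => measurableSet_nbhd _ (hCm n)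
  have hD : ∀ n, (∀ x g, Chain d (2 * q) (U n) x g → g ∈ box d (toastDiam q n)) →
      toastClosure d q (U n) (E n) ⊆ nbhd d (R n) (C n) := fun n hU =>
    (toastClosure_subset hU).trans (nbhd_subset_nbhd subset_rfl (by simp only [R]; omega))
  have hU : ∀ n x g, Chain d (2 * q) (U n) x g → g ∈ box d (toastDiam q n) := by
    intro n
    induction n with
    | zero =>
      intro x g h
      cases h with
      | start hx => exact hx.elim
      | step _ _ hx => exact hx.elim
    | succ n ih =>
      intro x g h
      exact Chain.union_mem_box ih (hD n ih) (hsep n _ (by simp only [R, κ]; omega)) x g h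
  refine ⟨R, C, fun n => toastClosure d q (U n) (E n), hCm, fun n =>
    measurableSet_toastClosure q (measurableSet_toastUnion q hEm n) (hEm n),
    fun n => hsep n _ (by simp only [R, κ]; omega), fun n => hD n (hU n), fun x => ?_, ?_⟩
  · obtain ⟨n, hn⟩ := hC x
    exact ⟨n, subset_toastClosure q _ _ hn⟩
  · intro m n hmn y hy hyn g hg
    exact vadd_mem_toastClosure (toastClosure_subset_toastUnion q E hmn hy) hyn hg

end toast

/-! ### Layers, parities and phases -/

/-- Data of a toast: pieces that cover `X`, whose boundaries at different levels are far apart,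
each near a sparse set of markers. -/
structure Toast (d q : ℕ) (X : Type u) [MeasurableSpace X] [AddAction (Fin d → ℤ) X] where
  radius : ℕ → ℕ
  marker : ℕ → Set X
  piece : ℕ → Set X
  measurableSet_marker : ∀ n, MeasurableSet (marker n)
  measurableSet_piece : ∀ n, MeasurableSet (piece n)
  separated : ∀ n, BoxSeparated d (2 * radius n + 8 * q) (marker n)
  piece_subset : ∀ n, piece n ⊆ nbhd d (radius n) (marker n)
  cover : ∀ x, ∃ n, x ∈ piece n
  vadd_mem : ∀ m n, m < n → ∀ y ∈ piece m, y ∈ nbhd d q (piece n) →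
    ∀ g ∈ box d q, g +ᵥ y ∈ piece n

theorem nonempty_toast {d : ℕ} {X : Type u} [AddAction (Fin d → ℤ) X] [MeasurableSpace X]
    [StandardBorelSpace X] [MeasurableConstVAdd (Fin d → ℤ) X] (hfree : IsFreeAction d X) (q : ℕ) :
    Nonempty (Toast d q X) := by
  obtain ⟨R, C, D, h1, h2, h3, h4, h5, h6⟩ := exists_toast hfree q
  exact ⟨⟨R, C, D, h1, h2, h3, h4, h5, h6⟩⟩

namespace Toast

variable {d q : ℕ} {X : Type u} [MeasurableSpace X] [AddAction (Fin d → ℤ) X] (T : Toast d q X)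

/-- The `i`-th thickening of a toast piece, made of blocks of side `2` that are aligned with
respect to the marker. -/
def layer (n : ℕ) (i : Fin d) : Set X :=
  {z | ∃ a b : Fin d → ℤ, a ∈ box d (T.radius n + q) ∧ (∀ k, a k / 2 = b k / 2) ∧
    b +ᵥ z ∈ T.marker n ∧ (b - a) +ᵥ z ∈ nbhd d (20 * i + 20) (T.piece n)}

/-- The marker of level `n` near `z` is at an even distance from `z` in direction `k`. -/
def IsEven (n : ℕ) (k : Fin d) (z : X) : Prop :=
  ∃ a ∈ box d (T.radius n + 2 * q), a +ᵥ z ∈ T.marker n ∧ Even (a k)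

/-- The edge `{x, y}` crosses the boundary of a layer. -/
def Crosses (n : ℕ) (i : Fin d) (x y : X) : Prop :=
  ¬(x ∈ T.layer n i ↔ y ∈ T.layer n i)

/-- The phase in direction `i`: the parity with respect to the innermost layer around the point. -/
def Phase (i : Fin d) (z : X) : Prop :=
  ∃ n, z ∈ T.layer n i ∧ (∀ m < n, z ∉ T.layer m i) ∧ T.IsEven n i z

/-- The point is close to the boundary of a layer. -/
def Near (n : ℕ) (i : Fin d) (z : X) : Prop :=
  z ∈ nbhd d (20 * i + 25) (T.piece n) ∧ z ∉ nbhd d (20 * i + 15) (T.piece n)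

/-- The `i`-edge at `z` crosses the boundary of a layer, and the phase does not alternate there. -/
def Flips (n : ℕ) (i : Fin d) (z : X) : Prop :=
  T.Crosses n i z ((Pi.single i 1 : Fin d → ℤ) +ᵥ z) ∧
    (T.Phase i ((Pi.single i 1 : Fin d → ℤ) +ᵥ z) ↔ T.Phase i z)

/-- The squares that contain `z`, given by the direction `i` of the edges that cross a boundary and
by the position of `z` in the square in the directions `i` and `p i`. -/
def squares (p : Fin d → Fin d) (z : X) : Set (Fin d × Bool × Bool) :=
  {s | ∃ n, (T.IsEven n s.1 z ↔ s.2.1 = true) ∧ (T.IsEven n (p s.1) z ↔ s.2.2 = false) ∧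
    T.Flips n s.1 ((if s.2.1 then 0 else -Pi.single s.1 1 : Fin d → ℤ) +ᵥ z)}

section measurable

variable [MeasurableConstVAdd (Fin d → ℤ) X]

theorem measurableSet_layer (n : ℕ) (i : Fin d) : MeasurableSet (T.layer n i) := by
  have : T.layer n i = ⋃ a : Fin d → ℤ, ⋃ b : Fin d → ℤ, ⋃ _ : a ∈ box d (T.radius n + q),
      ⋃ _ : ∀ k, a k / 2 = b k / 2, (fun z => b +ᵥ z) ⁻¹' T.marker n ∩
        (fun z => (b - a) +ᵥ z) ⁻¹' nbhd d (20 * i + 20) (T.piece n) := by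
    ext z
    simp only [layer, Set.mem_ofPred_eq, Set.mem_iUnion, Set.mem_inter_iff, Set.mem_preimage,
      exists_prop]
  rw [this]
  exact .iUnion fun a => .iUnion fun b => .iUnion fun _ => .iUnion fun _ =>
    (measurable_const_vadd b (T.measurableSet_marker n)).inter
      (measurable_const_vadd (b - a) (measurableSet_nbhd _ (T.measurableSet_piece n)))

theorem measurableSet_isEven (n : ℕ) (k : Fin d) : MeasurableSet {z | T.IsEven n k z} := by
  have : {z | T.IsEven n k z} = ⋃ a : Fin d → ℤ, ⋃ _ : a ∈ box d (T.radius n + 2 * q),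
      ⋃ _ : Even (a k), (fun z => a +ᵥ z) ⁻¹' T.marker n := by
    ext z
    simp only [IsEven, Set.mem_ofPred_eq, Set.mem_iUnion, Set.mem_preimage, exists_prop]
    exact exists_congr fun a => and_congr_right fun _ => and_comm
  rw [this]
  exact .iUnion fun a => .iUnion fun _ => .iUnion fun _ =>
    measurable_const_vadd a (T.measurableSet_marker n)

theorem measurableSet_phase (i : Fin d) : MeasurableSet {z | T.Phase i z} := by
  have : {z | T.Phase i z} = ⋃ n, T.layer n i ∩ ((⋂ m, ⋂ _ : m < n, (T.layer m i)ᶜ) ∩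
      {z | T.IsEven n i z}) := by
    ext z
    simp [Phase]
  rw [this]
  exact .iUnion fun n => (T.measurableSet_layer n i).inter ((MeasurableSet.iInter fun m =>
    .iInter fun _ => (T.measurableSet_layer m i).compl).inter (T.measurableSet_isEven n i))

theorem measurableSet_flips (n : ℕ) (i : Fin d) : MeasurableSet {z | T.Flips n i z} := by
  have h1 := measurableSet_setOfPred.1 (T.measurableSet_phase i)
  have h2 := measurableSet_setOfPred.1 (T.measurableSet_layer n i)
  have h := measurable_const_vadd (α := X) (Pi.single i 1 : Fin d → ℤ)
  exact measurableSet_setOfPred.2 ((h2.iff (h2.comp h)).not.and ((h1.comp h).iff h1))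

theorem measurableSet_squares (p : Fin d → Fin d) (s : Fin d × Bool × Bool) :
    MeasurableSet {z | s ∈ T.squares p z} := by
  refine measurableSet_setOfPred.2 (Measurable.exists fun n => ?_)
  have h1 := fun k => measurableSet_setOfPred.1 (T.measurableSet_isEven n k)
  exact ((h1 _).iff measurable_const).and (((h1 _).iff measurable_const).and
    ((measurableSet_setOfPred.1 (T.measurableSet_flips n s.1)).comp (measurable_const_vadd _)))

end measurable

theorem isEven_iff {n : ℕ} {k : Fin d} {z : X} {a : Fin d → ℤ}
    (ha : a ∈ box d (T.radius n + 2 * q)) (haz : a +ᵥ z ∈ T.marker n) :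
    T.IsEven n k z ↔ Even (a k) := by
  refine ⟨fun ⟨b, hb, hbz, hbk⟩ => ?_, fun h => ⟨a, ha, haz, h⟩⟩
  rwa [(T.separated n).offset_unique ha hb (by omega) haz hbz]

theorem nbhd_subset_layer (hq : 40 * d + 40 ≤ q) (n : ℕ) (i : Fin d) :
    nbhd d (20 * i + 20) (T.piece n) ⊆ T.layer n i := by
  intro z hz
  obtain ⟨a, ha, haz⟩ := nbhd_subset_nbhd (T.piece_subset n) le_rfl hz
  exact ⟨a, a, box_mono (by omega) ha, fun _ => rfl, haz, by simpa using hz⟩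

theorem layer_subset_nbhd (n : ℕ) (i : Fin d) :
    T.layer n i ⊆ nbhd d (20 * i + 21) (T.piece n) := by
  rintro z ⟨a, b, -, hab, -, hz⟩
  refine mem_nbhd_of_vadd_mem (r := 1) (fun k => ?_) hz (by omega)
  have := hab k
  simp only [Pi.sub_apply]
  rw [abs_le]
  push_cast
  omega

theorem layer_subset_nbhd_marker (hq : 40 * d + 40 ≤ q) (n : ℕ) (i : Fin d) :
    T.layer n i ⊆ nbhd d (T.radius n + q) (T.marker n) :=
  (T.layer_subset_nbhd n i).trans (nbhd_subset_nbhd (T.piece_subset n) (by omega))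

/-- A layer contains with a point that has odd offset in direction `k` also the next point in that
direction, and vice versa. -/
theorem not_crosses_of_not_isEven (hq : 40 * d + 40 ≤ q) {n : ℕ} {k : Fin d} {z : X}
    (hz : ¬T.IsEven n k z) (i : Fin d) :
    ¬T.Crosses n i z ((Pi.single k 1 : Fin d → ℤ) +ᵥ z) := by
  have hbox : ∀ a b : Fin d → ℤ, a ∈ box d (T.radius n + q) → (∀ k, a k / 2 = b k / 2) →
      b ∈ box d (T.radius n + q + 1) := fun a b ha hab l => by
    have := hab l
    have h1 := abs_le.1 (ha l)
    rw [abs_le]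
    push_cast at *
    omega
  unfold Crosses
  rw [not_not]
  constructor
  · rintro ⟨a, b, ha, hab, hb, hz'⟩
    have hk : ¬Even (b k) := fun h => hz ⟨b, box_mono (by omega) (hbox a b ha hab), hb, h⟩
    refine ⟨a, b - Pi.single k 1, ha, fun l => ?_, ?_, ?_⟩
    · by_cases hl : l = k
      · subst hl
        have := hab l
        rw [Int.even_iff] at hk
        simp only [Pi.sub_apply, Pi.single_eq_same]
        omega
      · simpa [hl] using hab l
    · rwa [vadd_vadd, sub_add_cancel]
    · rwa [vadd_vadd, sub_right_comm, sub_add_cancel]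
  · rintro ⟨a, b, ha, hab, hb, hz'⟩
    rw [vadd_vadd] at hb hz'
    have hk : ¬Even ((b + Pi.single k 1 : Fin d → ℤ) k) := fun h => hz ⟨b + Pi.single k 1,
      add_mem_box (hbox a b ha hab) (single_mem_box k) (by omega), hb, h⟩
    refine ⟨a, b + Pi.single k 1, ha, fun l => ?_, hb, by rwa [add_sub_right_comm]⟩
    by_cases hl : l = k
    · subst hl
      have := hab l
      rw [Int.even_iff] at hk
      simp only [Pi.add_apply, Pi.single_eq_same] at hk ⊢
      omega
    · simpa [hl] using hab l

theorem isEven_single_vadd (hq : 40 * d + 40 ≤ q) {n : ℕ} {z : X}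
    (hz : z ∈ nbhd d (T.radius n + q) (T.marker n)) (k l : Fin d) :
    T.IsEven n k ((Pi.single l 1 : Fin d → ℤ) +ᵥ z) ↔ (T.IsEven n k z ↔ k ≠ l) := by
  obtain ⟨a, ha, haz⟩ := hz
  have h1 : (a - Pi.single l 1) +ᵥ ((Pi.single l 1 : Fin d → ℤ) +ᵥ z) ∈ T.marker n := by
    rwa [vadd_vadd, sub_add_cancel]
  rw [T.isEven_iff (box_mono (by omega) ha) haz,
    T.isEven_iff (sub_mem_box ha (single_mem_box l) (by omega)) h1]
  by_cases hkl : k = l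
  · subst hkl
    simpa [-Int.not_even_iff_odd] using Int.not_even_iff_odd.symm
  · simp [hkl]

/-- If a point near the boundary of a level `m` piece is also near a piece of higher level `n`, the
toast property puts it inside the latter, away from its boundary. Within one level, the thickenings
for different directions differ by at least 20, more than the width 10 of the shells. -/
theorem near_unique (hq : 40 * d + 40 ≤ q) {m n : ℕ} {i j : Fin d} {z : X} (hm : T.Near m i z)
    (hn : T.Near n j z) : m = n ∧ i = j := by
  have key : ∀ {m n : ℕ} {i j : Fin d}, T.Near m i z → T.Near n j z → ¬m < n := by
    rintro m n i j ⟨⟨g, hg, hgz⟩, -⟩ ⟨hn, hn'⟩ hmn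
    have h1 : g +ᵥ z ∈ nbhd d q (T.piece n) := vadd_mem_nbhd hg hn (by omega)
    have h2 := T.vadd_mem m n hmn _ hgz h1 (-g) (box_mono (by omega) (neg_mem_box hg))
    rw [neg_vadd_vadd] at h2
    exact hn' (subset_nbhd _ _ h2)
  obtain rfl : m = n := le_antisymm (not_lt.1 (key hn hm)) (not_lt.1 (key hm hn))
  refine ⟨rfl, ?_⟩
  have key2 : ∀ {i j : Fin d}, T.Near m i z → T.Near m j z → ¬i < j := by
    intro i j hi hj hij
    have : (i : ℕ) < j := hij
    exact hj.2 (nbhd_mono (by omega) _ hi.1)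
  exact le_antisymm (not_lt.1 (key2 hn hm)) (not_lt.1 (key2 hm hn))

theorem Crosses.near (hq : 40 * d + 40 ≤ q) {n : ℕ} {i k : Fin d} {z : X}
    (h : T.Crosses n i z ((Pi.single k 1 : Fin d → ℤ) +ᵥ z)) {g : Fin d → ℤ} (hg : g ∈ box d 2) :
    T.Near n i (g +ᵥ z) := by
  have h1 : z ∈ nbhd d (20 * i + 22) (T.piece n) := by
    by_contra h0
    refine h ⟨fun h2 => (h0 ?_).elim, fun h2 => (h0 ?_).elim⟩
    · exact nbhd_mono (by omega) _ (T.layer_subset_nbhd n i h2)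
    · exact mem_nbhd_of_vadd_mem (single_mem_box k) (T.layer_subset_nbhd n i h2) (by omega)
  have h2 : z ∉ nbhd d (20 * i + 19) (T.piece n) := fun h0 =>
    h (iff_of_true (T.nbhd_subset_layer hq n i (nbhd_mono (by omega) _ h0))
      (T.nbhd_subset_layer hq n i (vadd_mem_nbhd (single_mem_box k) h0 (by omega))))
  exact ⟨vadd_mem_nbhd hg h1 (by omega), fun h0 => h2 (mem_nbhd_of_vadd_mem hg h0 (by omega))⟩

theorem Near.mem_nbhd_marker (hq : 40 * d + 40 ≤ q) {n : ℕ} {i : Fin d} {z : X}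
    (h : T.Near n i z) : z ∈ nbhd d (T.radius n + q) (T.marker n) :=
  nbhd_subset_nbhd (T.piece_subset n) (by omega) h.1

/-- Without a crossing both end points have the same first layer, so both parities refer to the same
marker. -/
theorem phase_single_vadd (hq : 40 * d + 40 ≤ q) {i k : Fin d} {z : X}
    (h : ∀ n, ¬T.Crosses n i z ((Pi.single k 1 : Fin d → ℤ) +ᵥ z)) :
    T.Phase i ((Pi.single k 1 : Fin d → ℤ) +ᵥ z) ↔ (T.Phase i z ↔ i ≠ k) := by
  classical
  have hex : ∃ n, z ∈ T.layer n i := by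
    obtain ⟨n, hn⟩ := T.cover z
    exact ⟨n, T.nbhd_subset_layer hq n i (subset_nbhd _ _ hn)⟩
  have key : ∀ (w : X) (n : ℕ), w ∈ T.layer n i → (∀ m < n, w ∉ T.layer m i) →
      (T.Phase i w ↔ T.IsEven n i w) := by
    intro w n hn hmin
    refine ⟨fun ⟨m, hm, hm', he⟩ => ?_, fun he => ⟨n, hn, hmin, he⟩⟩
    obtain rfl : m = n := le_antisymm (not_lt.1 fun hlt => hm' _ hlt hn)
      (not_lt.1 fun hlt => hmin _ hlt hm)
    exact he
  simp only [Crosses, not_not] at h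
  have h1 := Nat.find_spec hex
  have h2 : ∀ m < Nat.find hex, z ∉ T.layer m i := fun m hm => Nat.find_min hex hm
  rw [key z _ h1 h2, key _ _ ((h _).1 h1) (fun m hm h0 => h2 m hm ((h m).2 h0))]
  exact T.isEven_single_vadd hq (T.layer_subset_nbhd_marker hq _ i h1) i k

end Toast

/-! ### The squares of bad edges -/

namespace Toast

variable {d q : ℕ} {X : Type u} [MeasurableSpace X] [AddAction (Fin d → ℤ) X] (T : Toast d q X)

theorem Flips.near (hq : 40 * d + 40 ≤ q) {n : ℕ} {i : Fin d} {b : Bool} {z : X}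
    (h : T.Flips n i ((if b then 0 else -Pi.single i 1 : Fin d → ℤ) +ᵥ z)) {g : Fin d → ℤ}
    (hg : g ∈ box d 1) : T.Near n i (g +ᵥ z) := by
  have h1 : -(if b then 0 else -Pi.single i 1 : Fin d → ℤ) ∈ box d 1 := by
    cases b
    · simpa using single_mem_box i
    · simpa using zero_mem_box d 1
  have := Crosses.near T hq h.1 (add_mem_box hg h1 le_rfl)
  rwa [add_vadd, neg_vadd_vadd] at this

/-- Nearness determines the level and the direction, and then the parities of `z` determine its
position in the square. Thus distinct squares are disjoint. -/
theorem squares_subsingleton (hq : 40 * d + 40 ≤ q) (p : Fin d → Fin d) (z : X) :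
    (T.squares p z).Subsingleton := by
  rintro ⟨i, b, c⟩ ⟨m, h1, h2, h3⟩ ⟨j, b', c'⟩ ⟨n, h1', h2', h3'⟩
  have hm := Flips.near T hq h3 (zero_mem_box d 1)
  have hn := Flips.near T hq h3' (zero_mem_box d 1)
  obtain ⟨rfl, hij⟩ := T.near_unique hq hm hn
  dsimp only at hij h1 h2 h1' h2'
  subst hij
  rw [h1] at h1'
  rw [h2] at h2'
  have hb : b = b' := by revert h1'; cases b <;> cases b' <;> simp
  have hc : c = c' := by revert h2'; cases c <;> cases c' <;> simp
  rw [hb, hc]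

/-- The ends of an `i`-edge of a square see the same square, from opposite positions in direction
`i`. The primed version does the same for the `p i`-edges. -/
theorem squares_single_vadd (hq : 40 * d + 40 ≤ q) {p : Fin d → Fin d} (hp : ∀ i, p i ≠ i)
    (i : Fin d) (b : Bool) (z : X) :
    (i, true, b) ∈ T.squares p z ↔
      (i, false, b) ∈ T.squares p ((Pi.single i 1 : Fin d → ℤ) +ᵥ z) := by
  simp only [squares, Set.mem_ofPred_eq, if_true, zero_vadd, Bool.false_eq_true, if_false,
    neg_vadd_vadd]
  refine exists_congr fun n => ?_
  rw [← and_assoc, ← and_assoc]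
  refine and_congr_left fun h => ?_
  have hz : z ∈ nbhd d (T.radius n + q) (T.marker n) := by
    have := Near.mem_nbhd_marker T hq (Crosses.near T hq h.1 (zero_mem_box d 2))
    rwa [zero_vadd] at this
  rw [T.isEven_single_vadd hq hz, T.isEven_single_vadd hq hz]
  simp [hp i]

/-- Near a boundary for direction `i` there is none for direction `p i`. -/
theorem phase_of_squares (hq : 40 * d + 40 ≤ q) {p : Fin d → Fin d} (hp : ∀ i, p i ≠ i)
    {i : Fin d} {b : Bool} {z : X} (h : (i, true, b) ∈ T.squares p z) :
    T.Phase (p i) ((Pi.single i 1 : Fin d → ℤ) +ᵥ z) ↔ T.Phase (p i) z := by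
  obtain ⟨n, -, -, h⟩ := h
  have h0 := Flips.near T hq h (zero_mem_box d 1)
  rw [T.phase_single_vadd hq fun m hm => ?_]
  · simp [hp i]
  · exact hp i (T.near_unique hq (Crosses.near T hq hm (zero_mem_box d 2)) h0).2

/-- Across an edge in direction `k ≠ i` that joins two points of the same block, with both end
points near the boundary of a layer, nothing changes in direction `i`. -/
theorem phase_of_not_isEven (hq : 40 * d + 40 ≤ q) {n : ℕ} {i k : Fin d} (hik : i ≠ k) {z : X}
    (hz : T.Near n i z) (hk : ¬T.IsEven n k z) :
    T.Phase i ((Pi.single k 1 : Fin d → ℤ) +ᵥ z) ↔ T.Phase i z := by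
  rw [T.phase_single_vadd hq fun m hm => ?_]
  · simp [hik]
  · have h := Crosses.near T hq hm (zero_mem_box d 2)
    rw [zero_vadd] at h
    obtain ⟨rfl, -⟩ := T.near_unique hq h hz
    exact T.not_crosses_of_not_isEven hq hk i hm

theorem phase_of_squares' (hq : 40 * d + 40 ≤ q) {p : Fin d → Fin d} (hp : ∀ i, p i ≠ i)
    {i : Fin d} {b : Bool} {z : X} (h : (i, b, true) ∈ T.squares p z) :
    T.Phase i ((Pi.single (p i) 1 : Fin d → ℤ) +ᵥ z) ↔ T.Phase i z := by
  obtain ⟨n, -, h2, h⟩ := h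
  have h0 := Flips.near T hq h (zero_mem_box d 1)
  rw [zero_vadd] at h0
  exact T.phase_of_not_isEven hq (hp i).symm h0 (by simpa using h2)

/-- Bad edges come in pairs: a step inside a block changes neither layer membership nor the `i`
phase, at either end of the `i`-edge. -/
theorem flips_single_vadd (hq : 40 * d + 40 ≤ q) {n : ℕ} {i k : Fin d} (hik : i ≠ k) {z : X}
    (hz : T.Near n i z) (hz' : T.Near n i ((Pi.single i 1 : Fin d → ℤ) +ᵥ z))
    (hk : ¬T.IsEven n k z) :
    T.Flips n i ((Pi.single k 1 : Fin d → ℤ) +ᵥ z) ↔ T.Flips n i z := by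
  have hk' : ¬T.IsEven n k ((Pi.single i 1 : Fin d → ℤ) +ᵥ z) := by
    rw [T.isEven_single_vadd hq (Near.mem_nbhd_marker T hq hz)]
    simp [hk, hik.symm]
  have h1 := T.not_crosses_of_not_isEven hq hk i
  have h2 := T.not_crosses_of_not_isEven hq hk' i
  have h3 := T.phase_of_not_isEven hq hik hz hk
  have h4 := T.phase_of_not_isEven hq hik hz' hk'
  rw [vadd_comm] at h2 h4
  unfold Flips
  unfold Crosses at *
  rw [not_not] at h1 h2
  rw [h3, h4, h1, h2]

theorem squares_single_vadd' (hq : 40 * d + 40 ≤ q) {p : Fin d → Fin d} (hp : ∀ i, p i ≠ i)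
    (i : Fin d) (b : Bool) (z : X) :
    (i, b, true) ∈ T.squares p z ↔
      (i, b, false) ∈ T.squares p ((Pi.single (p i) 1 : Fin d → ℤ) +ᵥ z) := by
  simp only [squares, Set.mem_ofPred_eq]
  refine exists_congr fun n => ?_
  have hg : (if b then 0 else -Pi.single i 1 : Fin d → ℤ) ∈ box d 1 := by
    cases b
    · simpa using neg_mem_box (single_mem_box i)
    · simpa using zero_mem_box d 1
  have hgz : ∀ z : X, T.Near n i ((if b then 0 else -Pi.single i 1 : Fin d → ℤ) +ᵥ z) →
      (T.IsEven n (p i) ((if b then 0 else -Pi.single i 1 : Fin d → ℤ) +ᵥ z) ↔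
        T.IsEven n (p i) z) := by
    intro z hz
    cases b
    · have := T.isEven_single_vadd hq (Near.mem_nbhd_marker T hq hz) (p i) i
      simpa [hp i] using this.symm
    · simp
  set g : Fin d → ℤ := if b then 0 else -Pi.single i 1
  have key : T.Near n i z → T.Near n i (g +ᵥ z) →
      T.Near n i ((Pi.single i 1 : Fin d → ℤ) +ᵥ (g +ᵥ z)) → ¬T.IsEven n (p i) z →
      (T.Flips n i (g +ᵥ ((Pi.single (p i) 1 : Fin d → ℤ) +ᵥ z)) ↔ T.Flips n i (g +ᵥ z)) := by
    intro _ h1 h2 h3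
    rw [vadd_comm g]
    exact T.flips_single_vadd hq (hp i).symm h1 h2 (by rwa [hgz z h1])
  have hev : T.Near n i z → (T.IsEven n i ((Pi.single (p i) 1 : Fin d → ℤ) +ᵥ z) ↔
      T.IsEven n i z) ∧ (T.IsEven n (p i) ((Pi.single (p i) 1 : Fin d → ℤ) +ᵥ z) ↔
      ¬T.IsEven n (p i) z) := by
    intro h
    have h1 := Near.mem_nbhd_marker T hq h
    rw [T.isEven_single_vadd hq h1, T.isEven_single_vadd hq h1]
    simp [(hp i).symm]
  constructor
  · rintro ⟨h1, h2, h3⟩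
    have hnear := fun h hh => Crosses.near T hq h3.1 (g := h) hh
    have hz : T.Near n i z := by
      simpa using hnear (-g) (box_mono (by omega) (neg_mem_box hg))
    have h2' : ¬T.IsEven n (p i) z := by simpa using h2
    refine ⟨by rwa [(hev hz).1], by simpa [(hev hz).2] using h2', (key hz ?_ ?_ h2').2 h3⟩
    · simpa using hnear 0 (zero_mem_box d 2)
    · exact hnear _ (box_mono (by omega) (single_mem_box i))
  · rintro ⟨h1, h2, h3⟩
    have hnear := fun h hh => Crosses.near T hq h3.1 (g := h) hh
    have hz : T.Near n i z := by
      have := hnear (-Pi.single (p i) 1 + -g)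
        (add_mem_box (neg_mem_box (single_mem_box _)) (neg_mem_box hg) le_rfl)
      rwa [add_vadd, neg_vadd_vadd, neg_vadd_vadd] at this
    have h2' : ¬T.IsEven n (p i) z := by simpa [(hev hz).2] using h2
    refine ⟨by rwa [(hev hz).1] at h1, by simpa using h2', (key hz ?_ ?_ h2').1 h3⟩
    · have := hnear (-Pi.single (p i) 1) (box_mono (by omega) (neg_mem_box (single_mem_box _)))
      rwa [vadd_comm g, neg_vadd_vadd] at this
    · have := hnear (Pi.single i 1 + -Pi.single (p i) 1)
        (add_mem_box (single_mem_box _) (neg_mem_box (single_mem_box _)) le_rfl)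
      rwa [vadd_comm g, add_vadd, neg_vadd_vadd] at this

/-- Squares account for every failure: a crossing `i`-edge starts at an even point, and if the phase
does not alternate there, the parity in direction `p i` selects its square. -/
theorem phase_of_forall_notMem_squares (hq : 40 * d + 40 ≤ q) {p : Fin d → Fin d}
    {i : Fin d} {z : X} (h : ∀ b, (i, true, b) ∉ T.squares p z) :
    T.Phase i ((Pi.single i 1 : Fin d → ℤ) +ᵥ z) ↔ ¬T.Phase i z := by
  classical
  by_cases hc : ∃ n, T.Crosses n i z ((Pi.single i 1 : Fin d → ℤ) +ᵥ z)
  · obtain ⟨n, hn⟩ := hc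
    have he : T.IsEven n i z := by_contra fun h0 => T.not_crosses_of_not_isEven hq h0 i hn
    have := h (!decide (T.IsEven n (p i) z))
    by_contra hph
    refine this ⟨n, by simpa using he, by simp, ?_⟩
    simp only [if_true, zero_vadd]
    exact ⟨hn, by tauto⟩
  · rw [T.phase_single_vadd hq (not_exists.1 hc)]
    simp

end Toast

/-! ### Swapping half-edges and the resulting colouring -/

section halfEdges

variable {d : ℕ}

open Classical in
/-- At a corner of a square, the two half-edges of the square are swapped. -/
noncomputable def halfSwap (p : Fin d → Fin d) (A : Set (Fin d × Bool × Bool)) :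
    Equiv.Perm (Fin d × Bool) :=
  if h : A.Nonempty then
    Equiv.swap (h.choose.1, h.choose.2.1) (p h.choose.1, h.choose.2.2)
  else 1

theorem halfSwap_of_mem (p : Fin d → Fin d) {A : Set (Fin d × Bool × Bool)} (hA : A.Subsingleton)
    {i : Fin d} {b c : Bool} (h : (i, b, c) ∈ A) :
    halfSwap p A = Equiv.swap (i, b) (p i, c) := by
  have hne : A.Nonempty := ⟨_, h⟩
  rw [halfSwap, dif_pos hne, hA hne.choose_spec h]

theorem halfSwap_eq_self (p : Fin d → Fin d) (A : Set (Fin d × Bool × Bool))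
    {k : Fin d} {e : Bool} (h1 : ∀ c, (k, e, c) ∉ A) (h2 : ∀ i b, k = p i → (i, b, e) ∉ A) :
    halfSwap p A (k, e) = (k, e) := by
  unfold halfSwap
  split_ifs with h
  · obtain ⟨⟨i, b, c⟩, hx⟩ : ∃ x, x = h.choose := ⟨_, rfl⟩
    have hm := h.choose_spec
    rw [← hx] at hm ⊢
    refine Equiv.swap_apply_of_ne_of_ne ?_ ?_
    · rintro ⟨⟩
      exact h1 _ hm
    · rintro ⟨⟩
      exact h2 _ _ rfl hm
  · rfl

open Classical in
/-- The colour of a half-edge, given the phases and the squares at the vertex. -/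
noncomputable def halfColor (p : Fin d → Fin d) (t : Set (Fin d)) (A : Set (Fin d × Bool × Bool))
    (e : Fin d × Bool) : Fin d × Bool :=
  ((halfSwap p A e).1, (halfSwap p A e).2 ^^ decide ((halfSwap p A e).1 ∈ t))

theorem halfColor_injective (p : Fin d → Fin d) (t : Set (Fin d))
    (A : Set (Fin d × Bool × Bool)) : Function.Injective (halfColor p t A) := by
  intro e f h
  simp only [halfColor, Prod.mk.injEq] at h
  obtain ⟨h1, h2⟩ := h
  rw [h1] at h2
  exact (halfSwap p A).injective (Prod.ext h1 (Bool.xor_left_inj.1 h2))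

end halfEdges

namespace Toast

variable {d q : ℕ} {X : Type u} [MeasurableSpace X] [AddAction (Fin d → ℤ) X] (T : Toast d q X)

/-- The colour of a half-edge at `z`. -/
noncomputable def color (p : Fin d → Fin d) (z : X) (e : Fin d × Bool) : Fin d × Bool :=
  halfColor p {i | T.Phase i z} (T.squares p z) e

/-- The two halves of an edge agree. On an `i`-edge of a square the swapped colour depends on the `p
i` data, equal at both ends; on a `p i`-edge it depends on the `i` data, likewise equal; on any
other edge the phase alternates and compensates the change of sign. -/
theorem color_single_vadd (hq : 40 * d + 40 ≤ q) {p : Fin d → Fin d} (hp : ∀ i, p i ≠ i) (z : X)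
    (k : Fin d) : T.color p z (k, true) =
      T.color p ((Pi.single k 1 : Fin d → ℤ) +ᵥ z) (k, false) := by
  have hs := T.squares_subsingleton hq p
  unfold color halfColor
  by_cases h1 : ∃ c, (k, true, c) ∈ T.squares p z
  · obtain ⟨c, hc⟩ := h1
    rw [halfSwap_of_mem p (hs z) hc,
      halfSwap_of_mem p (hs _) ((T.squares_single_vadd hq hp k c z).1 hc), Equiv.swap_apply_left,
      Equiv.swap_apply_left]
    simp [T.phase_of_squares hq hp hc]
  by_cases h2 : ∃ i b, k = p i ∧ (i, b, true) ∈ T.squares p z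
  · obtain ⟨i, b, rfl, hc⟩ := h2
    rw [halfSwap_of_mem p (hs z) hc,
      halfSwap_of_mem p (hs _) ((T.squares_single_vadd' hq hp i b z).1 hc), Equiv.swap_apply_right,
      Equiv.swap_apply_right]
    simp [T.phase_of_squares' hq hp hc]
  push Not at h1 h2
  rw [halfSwap_eq_self p _ h1 h2, halfSwap_eq_self p _
    (fun c hc => h1 c ((T.squares_single_vadd hq hp k c z).2 hc))
    (fun i b hk hc => h2 i b hk ((T.squares_single_vadd' hq hp i b z).2 (hk ▸ hc)))]
  have := T.phase_of_forall_notMem_squares hq h1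
  by_cases hk : T.Phase k z <;> simp_all

end Toast

/-- A fixed-point-free map on the directions. -/
theorem exists_partner {d : ℕ} (hd : 2 ≤ d) : ∃ p : Fin d → Fin d, ∀ i, p i ≠ i := by
  have : Nontrivial (Fin d) := Fin.nontrivial_iff_two_le.2 hd
  choose p hp using fun i : Fin d => exists_ne i
  exact ⟨p, hp⟩

theorem inBorel_edgeColoringLCL {d : ℕ} (hd : 2 ≤ d) :
    LCL.InBorel.{u} (edgeColoringLCL d (2 * d)) := by
  intro X _ _ _ _ hfree inp _
  obtain ⟨p, hp⟩ := exists_partner hd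
  obtain ⟨T⟩ := nonempty_toast (X := X) hfree (40 * d + 40)
  let φ : Fin d × Bool ≃ Fin (2 * d) :=
    Fintype.equivFinOfCardEq (by simp [mul_comm])
  refine ⟨fun x i => φ (T.color p x (i, true)), ?_, fun x => ?_⟩
  · have h := measurable_top_of_finite
      (fun x => (Sum.inl '' {i | T.Phase i x} ∪ Sum.inr '' T.squares p x :
        Set (Fin d ⊕ (Fin d × Bool × Bool)))) (fun a => ?_)
      (fun A i => φ (halfColor p (Sum.inl ⁻¹' A) (Sum.inr ⁻¹' A) (i, true)))
    · have e1 : ∀ x, Sum.inl ⁻¹' (Sum.inl '' {i | T.Phase i x} ∪ Sum.inr '' T.squares p x :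
          Set (Fin d ⊕ (Fin d × Bool × Bool))) = {i | T.Phase i x} := fun x => by ext; simp
      have e2 : ∀ x, Sum.inr ⁻¹' (Sum.inl '' {i | T.Phase i x} ∪ Sum.inr '' T.squares p x :
          Set (Fin d ⊕ (Fin d × Bool × Bool))) = T.squares p x := fun x => by ext; simp
      simp only [e1, e2] at h
      exact h
    · rcases a with i | s
      · simpa using T.measurableSet_phase i
      · simpa using T.measurableSet_squares p s
  · change Function.Injective _
    convert φ.injective.comp (halfColor_injective p {i | T.Phase i x} (T.squares p x)) using 1
    funext ⟨i, b⟩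
    cases b
    · change φ _ = φ _
      rw [T.color_single_vadd le_rfl hp, vadd_vadd, add_neg_cancel, zero_vadd]
      rfl
    · change φ (T.color p ((0 : Fin d → ℤ) +ᵥ x) (i, true)) = _
      rw [zero_vadd]
      rfl

/-! ### The Borel edge chromatic number -/

section chromatic

variable {d : ℕ} {X : Type u} [AddAction (Fin d → ℤ) X]

/-- The signed generators. -/
def signedGenerator {d : ℕ} (e : Fin d × Bool) : Fin d → ℤ :=
  if e.2 then Pi.single e.1 1 else -Pi.single e.1 1

theorem signedGenerator_injective : Function.Injective (signedGenerator (d := d)) := by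
  rintro ⟨i, b⟩ ⟨j, c⟩ h
  have h1 := congrFun h i
  have h2 := congrFun h j
  by_cases hij : i = j
  · subst hij
    cases b <;> cases c <;> simp [signedGenerator] at h1 ⊢
  · cases b <;> cases c <;> simp [signedGenerator, hij] at h1

theorem signedGenerator_ne_zero (e : Fin d × Bool) : signedGenerator e ≠ 0 := by
  obtain ⟨i, b⟩ := e
  intro h
  have h1 := congrFun h i
  cases b <;> simp [signedGenerator] at h1

theorem signedGenerator_vadd_injective (hfree : IsFreeAction d X) (x : X) :
    Function.Injective fun e : Fin d × Bool => signedGenerator e +ᵥ x := by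
  intro e f h
  refine signedGenerator_injective (sub_eq_zero.1 (hfree.eq_zero (x := signedGenerator f +ᵥ x) ?_))
  rw [vadd_vadd, sub_add_cancel]
  exact h

variable [MeasurableSpace X] [StandardBorelSpace X] [MeasurableConstVAdd (Fin d → ℤ) X]

theorem actionGraph_adj_iff (hfree : IsFreeAction d X) (x y : X) :
    (actionGraph d X).Adj x y ↔ ∃ e : Fin d × Bool, y = signedGenerator e +ᵥ x := by
  change (SimpleGraph.fromRel _).Adj x y ↔ _
  rw [SimpleGraph.fromRel_adj]
  constructor
  · rintro ⟨-, ⟨i, rfl⟩ | ⟨i, rfl⟩⟩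
    · exact ⟨(i, true), rfl⟩
    · exact ⟨(i, false), by simp [signedGenerator]⟩
  · rintro ⟨⟨i, b⟩, rfl⟩
    refine ⟨fun h => signedGenerator_ne_zero _ (hfree.eq_zero h.symm), ?_⟩
    cases b
    · exact Or.inr ⟨i, by simp [signedGenerator]⟩
    · exact Or.inl ⟨i, rfl⟩

theorem two_mul_le_mk_of_isBorelEdgeColoring [Nonempty X] (hfree : IsFreeAction d X) {Y : Type}
    [MeasurableSpace Y] {c : {p : X × X // (actionGraph d X).Adj p.1 p.2} → Y}
    (hc : (actionGraph d X).IsBorelEdgeColoring c) :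
    ((2 * d : ℕ) : Cardinal.{0}) ≤ Cardinal.mk Y := by
  obtain ⟨x⟩ := ‹Nonempty X›
  have hadj := fun e : Fin d × Bool =>
    (actionGraph_adj_iff hfree x (signedGenerator e +ᵥ x)).2 ⟨e, rfl⟩
  have hinj : Function.Injective fun e => c ⟨(x, signedGenerator e +ᵥ x), hadj e⟩ := by
    intro e f h
    by_contra hne
    exact hc.2.2 x _ _ (hadj e) (hadj f)
      (fun h0 => hne (signedGenerator_vadd_injective hfree x h0)) h
  have := Cardinal.mk_le_of_injective hinj
  simpa [mul_comm] using this

/-- The color at `x` of the half-edge `e`, read off from a solution of the edge coloring problem. -/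
def edgeLabel {k : ℕ} (out : X → Fin d → Fin k) (x : X) (e : Fin d × Bool) : Fin k :=
  if e.2 then out x e.1 else out (-(Pi.single e.1 1 : Fin d → ℤ) +ᵥ x) e.1

theorem exists_isBorelEdgeColoring (hd : 2 ≤ d) (hfree : IsFreeAction d X) :
    ∃ c : {p : X × X // (actionGraph d X).Adj p.1 p.2} → Fin (2 * d),
      (actionGraph d X).IsBorelEdgeColoring c := by
  obtain ⟨out, hout, hcol⟩ := inBorel_edgeColoringLCL hd X hfree (fun _ => ()) measurable_const
  change X → Fin d → Fin (2 * d) at out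
  have hinj : ∀ x, Function.Injective (edgeLabel out x) := by
    intro x
    have h : Function.Injective _ := hcol x
    convert h using 1
    funext ⟨i, b⟩
    cases b
    · rfl
    · change _ = out ((0 : Fin d → ℤ) +ᵥ x) i
      rw [zero_vadd]
      rfl
  have hout' : ∀ i, Measurable fun x => out x i := fun i =>
    (@measurable_from_top _ _ _ fun f : Fin d → Fin (2 * d) => f i).comp hout
  have hlm : ∀ e, Measurable fun x => edgeLabel out x e := by
    rintro ⟨i, b⟩
    cases b
    · exact (hout' i).comp (measurable_const_vadd _)
    · exact hout' i
  -- By freeness the generator joining the end points is unique, so this choice is forced and hence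
  -- Borel.
  choose e he using fun p : {p : X × X // (actionGraph d X).Adj p.1 p.2} =>
    (actionGraph_adj_iff hfree p.1.1 p.1.2).1 p.2
  have hev : ∀ (x : X) (f : Fin d × Bool) h, e ⟨(x, signedGenerator f +ᵥ x), h⟩ = f := fun x f h =>
    (signedGenerator_vadd_injective hfree x (he ⟨(x, signedGenerator f +ᵥ x), h⟩)).symm
  refine ⟨fun p => edgeLabel out p.1.1 (e p), ?_, ?_, ?_⟩
  · have hem : ∀ f, MeasurableSet (e ⁻¹' {f}) := fun f => by
      have : e ⁻¹' {f} = {p | p.1.2 = signedGenerator f +ᵥ p.1.1} := by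
        ext p
        constructor
        · rintro rfl
          exact he p
        · intro h
          exact (signedGenerator_vadd_injective hfree p.1.1 (h.symm.trans (he p))).symm
      rw [this]
      exact measurableSet_eq_fun (measurable_snd.comp measurable_subtype_coe)
        ((measurable_fst.comp measurable_subtype_coe).const_vadd _)
    refine measurable_to_countable' fun a => ?_
    have : (fun p => edgeLabel out p.1.1 (e p)) ⁻¹' {a} =
        ⋃ f, e ⁻¹' {f} ∩ {p | edgeLabel out p.1.1 f = a} := by
      ext p
      simp
    rw [this]
    refine .iUnion fun f => (hem f).inter ?_
    exact ((hlm f).comp (measurable_fst.comp measurable_subtype_coe)) (measurableSet_singleton a)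
  · intro x y h
    obtain ⟨f, rfl⟩ := (actionGraph_adj_iff hfree x y).1 h
    obtain ⟨i, b⟩ := f
    have h1 := hev x (i, b) h
    have h2 : e ⟨(signedGenerator (i, b) +ᵥ x, x), h.symm⟩ = (i, !b) := by
      refine (signedGenerator_vadd_injective hfree (signedGenerator (i, b) +ᵥ x)
        ((?_ : _ = x).trans (he ⟨(signedGenerator (i, b) +ᵥ x, x), h.symm⟩))).symm
      cases b <;> simp [signedGenerator]
    simp only [h1, h2]
    cases b <;> simp [edgeLabel, signedGenerator]
  · intro x y z hy hz hyz h
    have := hinj x h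
    have h1 := he ⟨(x, y), hy⟩
    have h2 := he ⟨(x, z), hz⟩
    rw [this] at h1
    exact hyz (h1.trans h2.symm)

theorem borelEdgeChromaticNumber_actionGraph [Nonempty X] (hd : 2 ≤ d)
    (hfree : IsFreeAction d X) :
    (actionGraph d X).borelEdgeChromaticNumber = ((2 * d : ℕ) : Cardinal.{0}) := by
  obtain ⟨c, hc⟩ := exists_isBorelEdgeColoring hd hfree
  refine (IsLeast.csInf_eq ⟨⟨Fin (2 * d), inferInstance, inferInstance, c, hc, by simp⟩, ?_⟩)
  rintro _ ⟨Y, _, _, c', hc', rfl⟩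
  exact two_mul_le_mk_of_isBorelEdgeColoring hfree hc'

end chromatic

theorem mainTheorem10 (d : ℕ) (hd : 2 ≤ d) :
    LCL.InBorel.{u} (edgeColoringLCL d (2 * d)) ∧
    ∀ (X : Type u) [MeasurableSpace X] [StandardBorelSpace X] [Nonempty X]
      [AddAction (Fin d → ℤ) X] [MeasurableConstVAdd (Fin d → ℤ) X],
      IsFreeAction d X →
      (actionGraph d X).borelEdgeChromaticNumber = ((2 * d : ℕ) : Cardinal.{0}) := by
  exact ⟨inBorel_edgeColoringLCL hd, fun _ _ _ _ _ _ hfree =>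
    borelEdgeChromaticNumber_actionGraph hd hfree⟩
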